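/- Let $p,q\in\mathbb{Z}_{\ge 0}$ with $p<q$ and let $z\in\mathbb{Q}$, $z\neq 0$. Then the $q$ series $$\sum_{k\geq 0} \frac{z^k}{(k+1)^j \, (k!)^{q-p}},\qquad j=1,\dots,q,$$ converge absolutely, and the $q+1$ real numbers consisting of $1$ and the sums of these series are linearly independent over $\mathbb{Q}$. In particular, each of these $q$ sums is irrational. -/

import Mathlib

/-- The `k`-th term `z ^ k / ((k + 1) ^ j * k! ^ (q - p))` of the series. Only used for `p < q`, so
the subtraction of natural numbers is the true one. -/
noncomputable def confluentTerm (p q : ℕ) (z : ℚ) (j k : ℕ) : ℝ :=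
  (z : ℝ) ^ k / (((k : ℝ) + 1) ^ j * (k.factorial : ℝ) ^ (q - p))

/-- The constant `∑_{k ≥ 0} z ^ k / ((k + 1) ^ j * k! ^ (q - p))`. -/
noncomputable def confluentConst (p q : ℕ) (z : ℚ) (j : ℕ) : ℝ :=
  ∑' k : ℕ, confluentTerm p q z j k

/-! Put `r = q - p`. By clearing denominators, a rational relation makes `b * E 0` an integer, where
`z = a / b` and `E = remainderSum` satisfies `E (k + 1) = E k / z - lam k`. For each `n` and `s ≤
q`, the Padé-type form `F_s = altSum N (weight * E)` with `N = q * (n + 1)` is estimated in two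
ways.

Analytically, the first `n` terms of the series for `E` contribute `N`-th differences of polynomials
of degree below `N`, hence nothing; the tail gives `|F_s| ≤ C ^ n * n! ^ p` up to a constant
(`abs_altSum_weight_mul_rem_le`). Arithmetically, `F_s` times a factor of exponential growth is `n!
^ q` times an integer (`exists_int_altSum_weight`). If `F_s ≠ 0`, then `n! ^ r` grows at most
exponentially, which is false for large `n`.

For nontrivial coefficients some `F_s` is nonzero (`coeff_eq_zero_of_altSum_eq_zero`): otherwise
`weight * E` is interpolated by a polynomial of low degree, and the recurrence becomes a polynomial
identity that forces it to vanish. -/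

/-! ### Alternating binomial sums and interpolation -/

/-- The alternating binomial sum `∑_{k ≤ N} (-1)^(N-k) (N choose k) u k`. -/
noncomputable def altSum (N : ℕ) (u : ℕ → ℝ) : ℝ :=
  ∑ k ∈ Finset.range (N + 1), (-1) ^ (N - k) * (N.choose k : ℝ) * u k

lemma altSum_eval_eq_fwdDiff (N : ℕ) (P : Polynomial ℝ) :
    altSum N (fun k => P.eval (k : ℝ)) = (fwdDiff 1)^[N] P.eval 0 := by
  rw [fwdDiff_iter_eq_sum_shift, altSum]
  refine Finset.sum_congr rfl fun k _ => ?_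
  simp

lemma altSum_eval_eq_zero {N : ℕ} {P : Polynomial ℝ} (hP : P.natDegree < N) :
    altSum N (fun k => P.eval (k : ℝ)) = 0 := by
  rw [altSum_eval_eq_fwdDiff, Polynomial.fwdDiff_iter_eq_zero_of_degree_lt hP]
  rfl

lemma altSum_eval_ne_zero {N : ℕ} {P : Polynomial ℝ} (hP : P.natDegree = N) (h0 : P ≠ 0) :
    altSum N (fun k => P.eval (k : ℝ)) ≠ 0 := by
  subst hP
  rw [altSum_eval_eq_fwdDiff, Polynomial.fwdDiff_iter_degree_eq_factorial]
  simp [h0, Nat.factorial_ne_zero]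

lemma altSum_congr {N : ℕ} {u v : ℕ → ℝ} (h : ∀ k ≤ N, u k = v k) : altSum N u = altSum N v :=
  Finset.sum_congr rfl fun k hk => by rw [h k (Nat.lt_succ_iff.mp (Finset.mem_range.mp hk))]

lemma altSum_mul_left (N : ℕ) (a : ℝ) (u : ℕ → ℝ) :
    altSum N (fun k => a * u k) = a * altSum N u := by
  rw [altSum, altSum, Finset.mul_sum]
  exact Finset.sum_congr rfl fun k _ => by ring

lemma abs_altSum_le {N : ℕ} {u : ℕ → ℝ} {B : ℝ} (h : ∀ k ≤ N, |u k| ≤ B) :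
    |altSum N u| ≤ 2 ^ N * B := by
  calc |altSum N u| ≤ ∑ k ∈ Finset.range (N + 1), (N.choose k : ℝ) * B := by
        refine (Finset.abs_sum_le_sum_abs _ _).trans (Finset.sum_le_sum fun k hk => ?_)
        rw [abs_mul, abs_mul, abs_pow, abs_neg, abs_one, one_pow, one_mul, Nat.abs_cast]
        exact mul_le_mul_of_nonneg_left (h k (Nat.lt_succ_iff.mp (Finset.mem_range.mp hk)))
          (Nat.cast_nonneg _)
    _ = 2 ^ N * B := by
        rw [← Finset.sum_mul]
        congr 1
        exact_mod_cast Nat.sum_range_choose N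

/-- A function annihilated by `altSum N` against all powers `k ^ s`, `s ≤ q`, is interpolated on
`{0, …, N}` by a polynomial of degree less than `N - q`. -/
lemma exists_polynomial_of_altSum_eq_zero {N q : ℕ} {u : ℕ → ℝ}
    (h : ∀ s ≤ q, altSum N (fun k => u k * (k : ℝ) ^ s) = 0) :
    ∃ U : Polynomial ℝ, (U = 0 ∨ U.natDegree + q < N) ∧ ∀ k ≤ N, U.eval (k : ℝ) = u k := by
  have hinj : Set.InjOn (fun k : ℕ => (k : ℝ)) (Finset.range (N + 1)) :=
    fun _ _ _ _ h => Nat.cast_injective h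
  have hev : ∀ k ≤ N,
      (Lagrange.interpolate (Finset.range (N + 1)) (fun k : ℕ => (k : ℝ)) u).eval (k : ℝ) = u k :=
    fun k hk => Lagrange.eval_interpolate_at_node u hinj (Finset.mem_range.mpr (by omega))
  have hdeg := Lagrange.degree_interpolate_lt u hinj
  generalize Lagrange.interpolate (Finset.range (N + 1)) (fun k : ℕ => (k : ℝ)) u = U at hev hdeg
  refine ⟨U, ?_, hev⟩
  by_contra! hU
  obtain ⟨h0, hd⟩ := hU
  rw [Finset.card_range, Polynomial.degree_eq_natDegree h0, Nat.cast_lt] at hdeg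
  -- The power of `X` raises the degree to exactly `N`, where the `N`-th difference is `N!` times
  -- the leading coefficient.
  have h1 : altSum N (fun k => (U * Polynomial.X ^ (N - U.natDegree)).eval (k : ℝ)) = 0 := by
    rw [← h (N - U.natDegree) (by omega)]
    refine altSum_congr fun k hk => ?_
    rw [Polynomial.eval_mul, Polynomial.eval_pow, Polynomial.eval_X, hev k hk]
  refine altSum_eval_ne_zero ?_ ?_ h1
  · rw [Polynomial.natDegree_mul h0 (pow_ne_zero _ Polynomial.X_ne_zero),
      Polynomial.natDegree_X_pow]
    omega
  · exact mul_ne_zero h0 (pow_ne_zero _ Polynomial.X_ne_zero)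

/-! ### Divisibility and the shift equation -/

open Polynomial in
lemma isCoprime_X_add_C_pow {a b : ℝ} (h : a ≠ b) (m n : ℕ) :
    IsCoprime ((X + C a) ^ m) ((X + C b) ^ n) := by
  refine IsCoprime.pow ?_
  have := isCoprime_X_sub_C_of_isUnit_sub (R := ℝ) (a := -a) (b := -b)
    (sub_ne_zero.mpr (neg_injective.ne h)).isUnit
  simpa using this

open Polynomial in
/-- `∏_{a ≤ i < b} (X + i + 1)`, whose value at `k` is `(k + b)! / (k + a)!`. -/
noncomputable def shiftProd (a b : ℕ) : ℝ[X] :=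
  ∏ i ∈ Finset.Ico a b, (X + C ((i : ℝ) + 1))

open Polynomial in
lemma natDegree_shiftProd (a b : ℕ) : (shiftProd a b).natDegree = b - a := by
  rw [shiftProd, natDegree_prod_of_monic _ _ fun i _ => monic_X_add_C _]
  simp only [natDegree_X_add_C]
  simp

open Polynomial in
lemma eval_shiftProd_mul_factorial {a b : ℕ} (h : a ≤ b) (k : ℕ) :
    (shiftProd a b).eval (k : ℝ) * ((k + a).factorial : ℝ) = ((k + b).factorial : ℝ) := by
  induction b, h using Nat.le_induction with
  | base => simp [shiftProd]
  | succ b hab ih =>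
    rw [shiftProd, Finset.prod_Ico_succ_top hab, ← shiftProd, eval_mul, mul_right_comm, ih,
      ← add_assoc, Nat.factorial_succ]
    simp
    ring

-- Divisibility descends along the shift: if `(X + i + 1) ^ q` divides the term in `U` and the right
-- side, it divides `U (X + 1)`, being coprime to `X + 1`, so `(X + i) ^ q` divides `U`. Going from
-- `i = n` down to `1` yields a divisor of degree `q * n`, too large unless `U = 0`.
open Polynomial in
lemma eq_zero_of_shift_equation {p q n : ℕ} {x : ℝ}
    {U c : ℝ[X]} (hU : U = 0 ∨ U.natDegree < q * n)
    (h : (X + C 1) ^ p * U.comp (X + C 1) - C x * ((X + C ((n : ℝ) + 1)) ^ q * U) =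
      -(c * shiftProd 1 (n + 1) ^ q)) : U = 0 := by
  have key : ∀ d i : ℕ, i + d = n → (X + C ((i : ℝ) + 1)) ^ q ∣ (X + C ((n : ℝ) + 1)) ^ q * U ∧
      (1 ≤ i → (X + C (i : ℝ)) ^ q ∣ U) := by
    have step : ∀ i : ℕ, i ≤ n → (X + C ((i : ℝ) + 1)) ^ q ∣ (X + C ((n : ℝ) + 1)) ^ q * U →
        1 ≤ i → (X + C (i : ℝ)) ^ q ∣ U := by
      intro i hin hd hi
      have h1 : (X + C ((i : ℝ) + 1)) ^ q ∣ c * shiftProd 1 (n + 1) ^ q :=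
        Dvd.dvd.mul_left (pow_dvd_pow_of_dvd (Finset.dvd_prod_of_mem
          (fun i : ℕ => (X + C ((i : ℝ) + 1) : ℝ[X])) (Finset.mem_Ico.mpr ⟨hi, by omega⟩)) q) c
      have h2 : (X + C ((i : ℝ) + 1)) ^ q ∣ (X + C 1) ^ p * U.comp (X + C 1) := by
        rw [sub_eq_iff_eq_add.mp h]
        exact dvd_add (h1.neg_right) (hd.mul_left _)
      have hi' : (i : ℝ) + 1 ≠ 1 := by
        have : (i : ℝ) ≠ 0 := by exact_mod_cast (by omega : i ≠ 0)
        simpa using this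
      obtain ⟨V, hV⟩ := (isCoprime_X_add_C_pow hi' q p).dvd_of_dvd_mul_left h2
      refine ⟨V.comp (X - C 1), ?_⟩
      have h3 := congrArg (fun P : ℝ[X] => P.comp (X - C 1)) hV
      simp only [comp_assoc, mul_comp, pow_comp, add_comp, X_comp, C_comp, sub_add_cancel,
        comp_X] at h3
      rw [h3]
      congr 2
      rw [C_add]
      ring
    intro d
    induction d with
    | zero =>
      intro i hi
      have hi : i = n := by omega
      subst hi
      exact ⟨dvd_mul_right _ _, step i le_rfl (dvd_mul_right _ _)⟩
    | succ d ih =>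
      intro i hi
      have h1 : (X + C ((i : ℝ) + 1)) ^ q ∣ (X + C ((n : ℝ) + 1)) ^ q * U := by
        refine Dvd.dvd.mul_left ?_ _
        have := (ih (i + 1) (by omega)).2 (by omega)
        rwa [Nat.cast_add_one] at this
      exact ⟨h1, step i (by omega) h1⟩
  have hdvd : ∏ i ∈ Finset.range n, (X + C ((i : ℝ) + 1)) ^ q ∣ U := by
    refine Finset.prod_dvd_of_coprime (fun i _ j _ hij => isCoprime_X_add_C_pow ?_ q q) ?_
    · simpa using hij
    · intro i hi
      have := (key (n - (i + 1)) (i + 1) (by have := Finset.mem_range.mp hi; omega)).2 (by omega)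
      rwa [Nat.cast_add_one] at this
  rcases hU with hU | hU
  · exact hU
  · by_contra h0
    have := natDegree_le_of_dvd hdvd h0
    rw [natDegree_prod_of_monic _ _ fun i _ => (monic_X_add_C _).pow q] at this
    simp only [natDegree_pow, natDegree_X_add_C, Finset.sum_const, Finset.card_range,
      smul_eq_mul, mul_one] at this
    rw [mul_comm] at this
    omega

/-! ### Nonvanishing of the forms -/

/-- The Laurent polynomial `∑_{j < q} c j / (k + 1) ^ (j + 1)`. -/
noncomputable def kap (q : ℕ) (c : ℕ → ℝ) (k : ℕ) : ℝ :=
  ∑ j ∈ Finset.range q, c j / ((k : ℝ) + 1) ^ (j + 1)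

/-- The coefficients `kap q c k / k! ^ r` of the linear combination of series. -/
noncomputable def lam (q r : ℕ) (c : ℕ → ℝ) (k : ℕ) : ℝ :=
  kap q c k / (k.factorial : ℝ) ^ r

open Polynomial in
/-- The numerator of `kap q c`, with denominator `(X + 1) ^ q`. -/
noncomputable def kapNum (q : ℕ) (c : ℕ → ℝ) : ℝ[X] :=
  ∑ j ∈ Finset.range q, C (c j) * (X + C 1) ^ (q - 1 - j)

open Polynomial in
lemma eval_kapNum (q : ℕ) (c : ℕ → ℝ) (k : ℕ) :
    (kapNum q c).eval (k : ℝ) = kap q c k * ((k : ℝ) + 1) ^ q := by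
  rw [kapNum, kap, eval_finsetSum, Finset.sum_mul]
  refine Finset.sum_congr rfl fun j hj => ?_
  have hj := Finset.mem_range.mp hj
  have hk : (k : ℝ) + 1 ≠ 0 := by positivity
  have e : ((k : ℝ) + 1) ^ q = ((k : ℝ) + 1) ^ (q - 1 - j) * ((k : ℝ) + 1) ^ (j + 1) := by
    rw [← pow_add]; congr 1; omega
  simp only [eval_mul, eval_C, eval_pow, eval_add, eval_X]
  rw [e]
  field_simp

open Polynomial in
lemma natDegree_kapNum_le (q : ℕ) (c : ℕ → ℝ) : (kapNum q c).natDegree ≤ q - 1 := by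
  refine natDegree_sum_le_of_forall_le _ _ fun j _ => ?_
  refine (natDegree_C_mul_le _ _).trans ?_
  rw [natDegree_pow, natDegree_X_add_C]
  omega

open Polynomial in
lemma eq_zero_of_kapNum_eq_zero {q : ℕ} {c : ℕ → ℝ} (h : kapNum q c = 0) {j : ℕ} (hj : j < q) :
    c j = 0 := by
  -- After `X ↦ X - 1`, each `c j` is a single coefficient.
  have h1 := congrArg (fun P : ℝ[X] => (P.comp (X - C 1)).coeff (q - 1 - j)) h
  simp only [kapNum, sum_comp, mul_comp, pow_comp, add_comp, X_comp, C_comp, sub_add_cancel,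
    finsetSum_coeff, coeff_C_mul_X_pow, zero_comp, coeff_zero] at h1
  rw [Finset.sum_eq_single j] at h1
  · simpa using h1
  · intro i hi hij
    have := Finset.mem_range.mp hi
    rw [if_neg (by omega)]
  · intro hj'
    exact absurd (Finset.mem_range.mpr hj) hj'

open Polynomial in
/-- The explicit Padé-type polynomials do not all annihilate a solution `E` of the recurrence. -/
lemma coeff_eq_zero_of_altSum_eq_zero {p r n : ℕ} (hq : 0 < p + r) {c : ℕ → ℝ} {x : ℝ}
    {E : ℕ → ℝ} (hE : ∀ k, E (k + 1) = x * E k - lam (p + r) r c k)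
    (h : ∀ s ≤ p + r, altSum ((p + r) * (n + 1)) (fun k =>
      (shiftProd 0 n).eval (k : ℝ) ^ p * ((k + n).factorial : ℝ) ^ r * E k * (k : ℝ) ^ s) = 0) :
    ∀ j < p + r, c j = 0 := by
  obtain ⟨U, hU, hev⟩ := exists_polynomial_of_altSum_eq_zero h
  have hN : (p + r) * (n + 1) = (p + r) * n + (p + r) := by ring
  rw [hN] at hU hev
  -- The recurrence for `E`, cleared of denominators. It holds at `k = 0, …, N - 1`, and both sides
  -- have degree below `N`.
  have heq : (X + C 1) ^ p * U.comp (X + C 1) - C x * ((X + C ((n : ℝ) + 1)) ^ (p + r) * U) =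
      -(kapNum (p + r) c * shiftProd 1 (n + 1) ^ (p + r)) := by
    refine eq_of_natDegree_lt_card_of_eval_eq (ι := Fin ((p + r) * n + (p + r))) _ _
      (f := fun k => ((k : ℕ) : ℝ)) (fun a b hab => Fin.ext (Nat.cast_injective hab)) ?_ ?_
    · rintro ⟨k, hk⟩
      simp only [eval_sub, eval_mul, eval_pow, eval_add, eval_X, eval_C, eval_comp, eval_neg,
        eval_kapNum]
      have h1 := hev (k + 1) (by omega)
      rw [Nat.cast_add_one] at h1
      rw [h1, hev k (by omega), hE]
      have e0 := eval_shiftProd_mul_factorial (Nat.zero_le n) k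
      have e1 := eval_shiftProd_mul_factorial (Nat.zero_le n) (k + 1)
      have e2 := eval_shiftProd_mul_factorial (Nat.le_add_left 1 n) k
      rw [add_zero] at e0 e1
      have f1 : (((k + 1).factorial : ℕ) : ℝ) = ((k : ℝ) + 1) * (k.factorial : ℝ) := by
        rw [Nat.factorial_succ]; push_cast; ring
      have f2 : (((k + (n + 1)).factorial : ℕ) : ℝ) =
          ((k : ℝ) + ((n : ℝ) + 1)) * ((k + n).factorial : ℝ) := by
        rw [← add_assoc, Nat.factorial_succ]; push_cast; ring
      have f3 : (k + 1 + n).factorial = (k + (n + 1)).factorial := by congr 1; ring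
      rw [f3] at e1
      rw [f3]
      rw [Nat.cast_add_one] at e1
      rw [f1, f2] at e1 e2
      rw [f2, lam]
      have hk0 : (k.factorial : ℝ) ≠ 0 := by positivity
      have hk1 : (k : ℝ) + 1 ≠ 0 := by positivity
      generalize (shiftProd 0 n).eval ((k : ℝ) + 1) = w1 at *
      generalize (shiftProd 0 n).eval (k : ℝ) = w0 at *
      generalize (shiftProd 1 (n + 1)).eval (k : ℝ) = w2 at *
      rw [← e0] at e1 e2 ⊢
      generalize (k.factorial : ℝ) = g at *
      generalize (k : ℝ) + ((n : ℝ) + 1) = y at *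
      generalize (k : ℝ) + 1 = v at *
      have a1 : v * w1 = y * w0 := mul_right_cancel₀ hk0 (by linear_combination e1)
      have a2 : w2 * v = y * w0 := mul_right_cancel₀ hk0 (by linear_combination e2)
      calc v ^ p * (w1 ^ p * (y * (w0 * g)) ^ r * (x * E k - kap (p + r) c k / g ^ r)) -
            x * (y ^ (p + r) * (w0 ^ p * (w0 * g) ^ r * E k))
          = (v * w1) ^ p * (y * (w0 * g)) ^ r * (x * E k - kap (p + r) c k / g ^ r) -
            x * (y ^ (p + r) * (w0 ^ p * (w0 * g) ^ r * E k)) := by ring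
        _ = -(kap (p + r) c k * (y * w0) ^ (p + r)) := by
            rw [a1]
            field_simp
            ring
        _ = -(kap (p + r) c k * v ^ (p + r) * w2 ^ (p + r)) := by
            rw [← a2]
            ring
    · rw [Fintype.card_fin, max_lt_iff]
      constructor
      · rcases hU with rfl | hU
        · simp only [zero_comp, mul_zero, sub_zero, natDegree_zero]
          omega
        · refine (natDegree_sub_le _ _).trans_lt (max_lt ?_ ?_)
          · refine natDegree_mul_le.trans_lt ?_
            rw [natDegree_pow, natDegree_X_add_C, natDegree_comp, natDegree_X_add_C]
            omega
          · refine (natDegree_C_mul_le _ _).trans_lt (natDegree_mul_le.trans_lt ?_)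
            rw [natDegree_pow, natDegree_X_add_C]
            omega
      · rw [natDegree_neg]
        refine natDegree_mul_le.trans_lt ?_
        have := natDegree_kapNum_le (p + r) c
        rw [natDegree_pow, natDegree_shiftProd, Nat.add_sub_cancel]
        omega
  have hU0 : U = 0 := eq_zero_of_shift_equation (hU.imp_right fun h => by omega) heq
  intro j hj
  refine eq_zero_of_kapNum_eq_zero (c := c) ?_ hj
  have hs : shiftProd 1 (n + 1) ≠ 0 :=
    (monic_prod_of_monic _ _ fun i _ => monic_X_add_C _).ne_zero
  subst hU0
  simpa [hs] using heq

/-! ### Upper bound for the forms -/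

/-- The remainders `∑_{m ≥ 0} lam (m + k) z ^ (m + 1)`. -/
noncomputable def remainderSum (q r : ℕ) (c : ℕ → ℝ) (z : ℝ) (k : ℕ) : ℝ :=
  ∑' m : ℕ, lam q r c (m + k) * z ^ (m + 1)

/-- The `t ^ k`-coefficients of the Padé-type polynomials, up to binomial factors and sign. -/
noncomputable def weight (p r n s k : ℕ) : ℝ :=
  (Polynomial.eval (k : ℝ) (shiftProd 0 n)) ^ p * ((k + n).factorial : ℝ) ^ r * (k : ℝ) ^ s

lemma abs_kap_le (q : ℕ) (c : ℕ → ℝ) (k : ℕ) :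
    |kap q c k| ≤ ∑ j ∈ Finset.range q, |c j| := by
  refine (Finset.abs_sum_le_sum_abs _ _).trans (Finset.sum_le_sum fun j _ => ?_)
  have h : (1 : ℝ) ≤ ((k : ℝ) + 1) ^ (j + 1) := one_le_pow₀ (by simp)
  rw [abs_div, abs_of_nonneg (zero_le_one.trans h)]
  exact div_le_self (abs_nonneg _) h

lemma factorial_div_factorial_pow_le {r : ℕ} (hr : 0 < r) (m k : ℕ) :
    (k.factorial : ℝ) ^ r / ((m + k).factorial : ℝ) ^ r ≤ 1 / (m.factorial : ℝ) := by
  have h : (m.factorial : ℝ) * (k.factorial : ℝ) ≤ ((m + k).factorial : ℝ) := by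
    exact_mod_cast Nat.le_of_dvd (Nat.factorial_pos _) (Nat.factorial_mul_factorial_dvd_factorial_add m k)
  have hm : (1 : ℝ) ≤ (m.factorial : ℝ) := by exact_mod_cast Nat.factorial_pos m
  have h1 : (k.factorial : ℝ) / ((m + k).factorial : ℝ) ≤ 1 / (m.factorial : ℝ) := by
    rw [div_le_div_iff₀ (by positivity) (by positivity)]
    linarith
  rw [← div_pow]
  refine (pow_le_of_le_one (by positivity) (h1.trans ?_) hr.ne').trans h1
  rw [div_le_one (by positivity)]
  exact hm

lemma summable_lam {q r : ℕ} (hr : 0 < r) (c : ℕ → ℝ) (z : ℝ) (k : ℕ) :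
    Summable fun m : ℕ => lam q r c (m + k) * z ^ (m + 1) := by
  refine Summable.of_norm_bounded
    (((Real.summable_pow_div_factorial |z|).mul_left ((∑ j ∈ Finset.range q, |c j|) * |z|))) ?_
  intro m
  have h1 := factorial_div_factorial_pow_le hr m k
  have hk : (1 : ℝ) ≤ (k.factorial : ℝ) ^ r := one_le_pow₀ (by exact_mod_cast Nat.factorial_pos k)
  have h2 : 1 / ((m + k).factorial : ℝ) ^ r ≤ 1 / (m.factorial : ℝ) :=
    (div_le_div_of_nonneg_right hk (by positivity)).trans h1
  rw [Real.norm_eq_abs, abs_mul, abs_pow, lam, abs_div, abs_pow, Nat.abs_cast]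
  calc |kap q c (m + k)| / ((m + k).factorial : ℝ) ^ r * |z| ^ (m + 1)
      = |kap q c (m + k)| * |z| ^ (m + 1) * (1 / ((m + k).factorial : ℝ) ^ r) := by ring
    _ ≤ (∑ j ∈ Finset.range q, |c j|) * |z| ^ (m + 1) * (1 / (m.factorial : ℝ)) := by
        gcongr
        exact abs_kap_le q c _
    _ = (∑ j ∈ Finset.range q, |c j|) * |z| * (|z| ^ m / (m.factorial : ℝ)) := by ring

lemma rem_eq {q r : ℕ} (hr : 0 < r) (c : ℕ → ℝ) (z : ℝ) (k : ℕ) :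
    remainderSum q r c z k = z * (lam q r c k + remainderSum q r c z (k + 1)) := by
  rw [remainderSum, (summable_lam hr c z k).tsum_eq_zero_add, remainderSum, mul_add, ← tsum_mul_left]
  congr 1
  · simp [mul_comm]
  · refine tsum_congr fun m => ?_
    rw [add_right_comm m 1 k, add_assoc m k 1]
    ring

lemma eval_shiftProd_zero (n k : ℕ) :
    (shiftProd 0 n).eval (k : ℝ) = (n.factorial : ℝ) * ((k + n).choose n : ℝ) := by
  have h := eval_shiftProd_mul_factorial (Nat.zero_le n) k
  have hk : (k.factorial : ℝ) ≠ 0 := by positivity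
  refine mul_right_cancel₀ hk ?_
  rw [add_zero] at h
  rw [h, mul_comm (n.factorial : ℝ)]
  have := Nat.add_choose_mul_factorial_mul_factorial k n
  rw [mul_right_comm] at this
  exact_mod_cast this.symm

-- For `m < n` the weight contains `(k + m + 1) ^ p` from the shifted product and `(k + m + 1) ^ r`
-- from the factorials, which together cancel the denominator of `kap` at `m + k`. What remains is a
-- polynomial in `k` of degree below `N`.
open Polynomial in
lemma altSum_weight_mul_lam {p r m n s : ℕ} (hq : 0 < p + r) (hmn : m < n) (hs : s ≤ p + r)
    (c : ℕ → ℝ) :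
    altSum ((p + r) * (n + 1)) (fun k => weight p r n s k * lam (p + r) r c (m + k)) = 0 := by
  obtain ⟨d, rfl⟩ := Nat.exists_eq_add_of_lt hmn
  have hdeg : (X ^ s * shiftProd 0 m ^ p * shiftProd (m + 1) (m + d + 1) ^ (p + r) *
      (kapNum (p + r) c).comp (X + C (m : ℝ))).natDegree < (p + r) * (m + d + 1 + 1) := by
    have h1 : ((kapNum (p + r) c).comp (X + C (m : ℝ))).natDegree ≤ p + r - 1 := by
      rw [natDegree_comp, natDegree_X_add_C, mul_one]
      exact natDegree_kapNum_le _ _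
    have h2 : (X ^ s * shiftProd 0 m ^ p * shiftProd (m + 1) (m + d + 1) ^ (p + r)).natDegree ≤
        s + p * m + (p + r) * d := by
      refine natDegree_mul_le.trans (add_le_add (natDegree_mul_le.trans (add_le_add ?_ ?_)) ?_)
      · rw [natDegree_X_pow]
      · rw [natDegree_pow, natDegree_shiftProd, Nat.sub_zero]
      · rw [natDegree_pow, natDegree_shiftProd]
        exact Nat.mul_le_mul_left _ (by omega)
    refine natDegree_mul_le.trans_lt ?_
    have h3 : (p + r) * (m + d + 1 + 1) = p * m + r * m + (p + r) * d + (p + r) + (p + r) := by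
      ring
    omega
  rw [← altSum_eval_eq_zero hdeg]
  refine altSum_congr fun k _ => ?_
  have e1 := eval_shiftProd_mul_factorial (Nat.zero_le m) k
  have e2 := eval_shiftProd_mul_factorial (show m + 1 ≤ m + d + 1 by omega) k
  have e3 := eval_shiftProd_mul_factorial (Nat.zero_le (m + d + 1)) k
  have e4 := eval_kapNum (p + r) c (m + k)
  have f1 : (((k + (m + 1)).factorial : ℕ) : ℝ) =
      ((m : ℝ) + k + 1) * ((m + k).factorial : ℝ) := by
    rw [← add_assoc, Nat.factorial_succ, add_comm k m]; push_cast; ring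
  have f2 : (k + m).factorial = (m + k).factorial := by rw [add_comm]
  simp only [eval_mul, eval_pow, eval_X, eval_comp, eval_add, eval_C]
  rw [Nat.cast_add] at e4
  rw [add_comm (k : ℝ) m, e4, weight, lam, ← e2, f1]
  rw [← e2, f1, add_zero] at e3
  rw [f2, add_zero] at e1
  rw [← e1] at e3 ⊢
  have hk : (k.factorial : ℝ) ≠ 0 := by positivity
  have hm : (shiftProd 0 m).eval (k : ℝ) ≠ 0 := by
    rw [eval_shiftProd_zero]
    have : 0 < (k + m).choose m := Nat.choose_pos (by omega)
    positivity
  generalize (shiftProd 0 m).eval (k : ℝ) = w0 at *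
  generalize (shiftProd 0 (m + d + 1)).eval (k : ℝ) = w at *
  generalize (shiftProd (m + 1) (m + d + 1)).eval (k : ℝ) = w2 at *
  generalize (m : ℝ) + k + 1 = y at *
  have e5 : w = w2 * y * w0 := mul_right_cancel₀ hk (by linear_combination e3)
  rw [e5]
  field_simp
  ring

lemma abs_weight_mul_lam_le {p r m n s k N : ℕ} (hr : 0 < r) (hs : s ≤ p + r) (hk : k ≤ N)
    (c : ℕ → ℝ) :
    |weight p r n s k * lam (p + r) r c (m + n + k)| ≤
      (n.factorial : ℝ) ^ p * (2 ^ (N + n)) ^ p * (2 ^ N) ^ (p + r) *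
        (∑ j ∈ Finset.range (p + r), |c j|) * (1 / (m.factorial : ℝ)) := by
  have h1 : (shiftProd 0 n).eval (k : ℝ) ≤ (n.factorial : ℝ) * 2 ^ (N + n) := by
    rw [eval_shiftProd_zero]
    gcongr
    calc ((k + n).choose n : ℝ) ≤ 2 ^ (k + n) := by exact_mod_cast Nat.choose_le_two_pow _ _
      _ ≤ 2 ^ (N + n) := pow_le_pow_right₀ one_le_two (by omega)
  have h0 : 0 ≤ (shiftProd 0 n).eval (k : ℝ) := by
    rw [eval_shiftProd_zero]; positivity
  have h2 : (k : ℝ) ^ s ≤ (2 ^ N) ^ (p + r) := by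
    have : (k : ℝ) ≤ 2 ^ N := by exact_mod_cast hk.trans Nat.lt_two_pow_self.le
    exact (pow_le_pow_left₀ (Nat.cast_nonneg _) this s).trans
      (pow_le_pow_right₀ (one_le_pow₀ one_le_two) hs)
  have h3 := factorial_div_factorial_pow_le hr m (k + n)
  have h4 : m + (k + n) = m + n + k := by ring
  rw [h4] at h3
  have h5 := abs_kap_le (p + r) c (m + n + k)
  rw [weight, lam]
  calc _ = (shiftProd 0 n).eval (k : ℝ) ^ p * (k : ℝ) ^ s * |kap (p + r) c (m + n + k)| *
        (((k + n).factorial : ℝ) ^ r / ((m + n + k).factorial : ℝ) ^ r) := by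
        rw [abs_mul, abs_div, abs_mul, abs_mul, abs_pow, abs_pow, abs_pow, abs_pow,
          abs_of_nonneg h0, Nat.abs_cast, Nat.abs_cast, Nat.abs_cast]
        ring
    _ ≤ ((n.factorial : ℝ) * 2 ^ (N + n)) ^ p * (2 ^ N) ^ (p + r) *
        (∑ j ∈ Finset.range (p + r), |c j|) * (1 / (m.factorial : ℝ)) := by
        gcongr
    _ = _ := by rw [mul_pow]

lemma abs_altSum_weight_mul_rem_le {p r n s : ℕ} (hr : 0 < r) (hs : s ≤ p + r)
    (c : ℕ → ℝ) (z : ℝ) :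
    |altSum ((p + r) * (n + 1)) (fun k => weight p r n s k * remainderSum (p + r) r c z k)| ≤
      2 ^ ((p + r) * (n + 1)) * ((n.factorial : ℝ) ^ p * (2 ^ ((p + r) * (n + 1) + n)) ^ p *
        (2 ^ ((p + r) * (n + 1))) ^ (p + r) * (∑ j ∈ Finset.range (p + r), |c j|)) *
        |z| ^ (n + 1) * ∑' m : ℕ, |z| ^ m / (m.factorial : ℝ) := by
  set N := (p + r) * (n + 1) with hN
  have hsum : HasSum (fun m : ℕ => altSum N fun k => weight p r n s k *
      (lam (p + r) r c (m + k) * z ^ (m + 1)))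
      (altSum N (fun k => weight p r n s k * remainderSum (p + r) r c z k)) := by
    refine hasSum_sum fun k _ => ?_
    exact (((summable_lam hr c z k).hasSum.mul_left _).mul_left _)
  have hterm : ∀ m, (altSum N fun k => weight p r n s k *
      (lam (p + r) r c (m + k) * z ^ (m + 1))) =
      z ^ (m + 1) * altSum N fun k => weight p r n s k * lam (p + r) r c (m + k) := by
    intro m
    rw [← altSum_mul_left]
    exact altSum_congr fun k _ => by ring
  simp only [hterm] at hsum
  -- The terms `m < n` vanish; the tail is reindexed by `m + n`.
  rw [← hsum.tsum_eq, ← hsum.summable.sum_add_tsum_nat_add n, Finset.sum_eq_zero, zero_add,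
    ← Real.norm_eq_abs, mul_assoc]
  · refine tsum_of_norm_bounded
      (((Real.summable_pow_div_factorial |z|).hasSum.mul_left (|z| ^ (n + 1))).mul_left _) fun m => ?_
    have h := abs_altSum_le (N := N) fun k hk =>
      abs_weight_mul_lam_le (m := m) (n := n) (p := p) (s := s) hr hs hk c
    rw [Real.norm_eq_abs, abs_mul, abs_pow]
    refine (mul_le_mul_of_nonneg_left h (by positivity)).trans (le_of_eq ?_)
    ring
  · intro m hm
    rw [hN, altSum_weight_mul_lam (by omega) (Finset.mem_range.mp hm) hs, mul_zero]

/-! ### Denominators -/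

lemma lcmUpto_le_exp_pow (N : ℕ) :
    (Nat.lcmUpto N : ℝ) ≤ Real.exp (Real.log 4 + 4) ^ N := by
  have h := Chebyshev.psi_le_const_mul_self (Nat.cast_nonneg (α := ℝ) N)
  rw [Chebyshev.psi_eq_log_lcmUpto] at h
  rw [← Real.exp_nat_mul, mul_comm]
  have h0 : (0 : ℝ) < Nat.lcmUpto N := by exact_mod_cast Nat.lcmUpto_pos N
  exact (Real.log_le_iff_le_exp h0).mp h

lemma exists_int_kap_mul {q k d : ℕ} (c : ℕ → ℤ) (hd : k + 1 ∣ d) :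
    ∃ M : ℤ, kap q (fun j => (c j : ℝ)) k * (d : ℝ) ^ q = M := by
  obtain ⟨e, rfl⟩ := hd
  refine ⟨∑ j ∈ Finset.range q, c j * (e ^ (j + 1) * ((k + 1) * e) ^ (q - (j + 1))), ?_⟩
  rw [kap, Finset.sum_mul, Int.cast_sum]
  refine Finset.sum_congr rfl fun j hj => ?_
  have hk : (k : ℝ) + 1 ≠ 0 := by positivity
  have hq : q = (j + 1) + (q - (j + 1)) := by have := Finset.mem_range.mp hj; omega
  have e1 : (((k + 1) * e : ℕ) : ℝ) ^ q = ((k : ℝ) + 1) ^ (j + 1) * (e : ℝ) ^ (j + 1) *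
      (((k : ℝ) + 1) * e) ^ (q - (j + 1)) := by
    conv_lhs => rw [hq, pow_add]
    rw [← mul_pow]
    push_cast
    rfl
  rw [e1]
  push_cast
  field_simp

/-- Each step of the recurrence costs one factor `a` and a factor `(k + 1) ^ r`, while `d ^ q`
clears every `kap` at once. -/
lemma exists_int_recurrence {q r N d : ℕ} (hd : ∀ k < N, k + 1 ∣ d) {c : ℕ → ℤ} {a b : ℤ}
    (ha : a ≠ 0) {E : ℕ → ℝ}
    (hE : ∀ k, E (k + 1) = (b : ℝ) / a * E k - lam q r (fun j => (c j : ℝ)) k)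
    (h0 : ∃ M : ℤ, (b : ℝ) * E 0 = M) :
    ∀ k ≤ N, ∃ M : ℤ, (a : ℝ) ^ k * b * (k.factorial : ℝ) ^ r * (d : ℝ) ^ q * E k = M := by
  intro k
  induction k with
  | zero =>
    intro _
    obtain ⟨M, hM⟩ := h0
    refine ⟨d ^ q * M, ?_⟩
    push_cast
    rw [← hM]
    simp
    ring
  | succ k ih =>
    intro hk
    obtain ⟨M, hM⟩ := ih (by omega)
    obtain ⟨L, hL⟩ := exists_int_kap_mul (q := q) c (hd k (by omega))
    refine ⟨(k + 1) ^ r * b * M - a ^ (k + 1) * b * (k + 1) ^ r * L, ?_⟩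
    push_cast
    rw [← hM, ← hL, hE, lam, Nat.factorial_succ, Nat.cast_mul, mul_pow]
    push_cast
    have ha' : (a : ℝ) ≠ 0 := by exact_mod_cast ha
    have hk0 : (k.factorial : ℝ) ≠ 0 := by positivity
    field_simp
    ring

lemma weight_eq (p r n s k : ℕ) :
    weight p r n s k =
      (n.factorial : ℝ) ^ (p + r) * ((k + n).choose n ^ (p + r) * (k.factorial : ℝ) ^ r * k ^ s) := by
  have h := eval_shiftProd_mul_factorial (Nat.zero_le n) k
  rw [add_zero, eval_shiftProd_zero] at h
  rw [weight, eval_shiftProd_zero, ← h]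
  ring

/-- By `weight_eq`, the weight supplies the `k! ^ r` needed to clear `E k` and still leaves `n! ^
q`, independent of `k`. -/
lemma exists_int_altSum_weight {p r n s N d : ℕ} {a b : ℤ} {E : ℕ → ℝ}
    (h : ∀ k ≤ N, ∃ M : ℤ,
      (a : ℝ) ^ k * b * (k.factorial : ℝ) ^ r * (d : ℝ) ^ (p + r) * E k = M) :
    ∃ M : ℤ, (a : ℝ) ^ N * b * (d : ℝ) ^ (p + r) * altSum N (fun k => weight p r n s k * E k) =
      (n.factorial : ℝ) ^ (p + r) * M := by
  choose! M hM using h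
  refine ⟨∑ k ∈ Finset.range (N + 1), (-1) ^ (N - k) * N.choose k *
    (a ^ (N - k) * ((k + n).choose n ^ (p + r) * k ^ s * M k)), ?_⟩
  rw [altSum, Finset.mul_sum, Int.cast_sum, Finset.mul_sum]
  refine Finset.sum_congr rfl fun k hk => ?_
  have hk : k ≤ N := Nat.lt_succ_iff.mp (Finset.mem_range.mp hk)
  have e : (a : ℝ) ^ N = (a : ℝ) ^ (N - k) * (a : ℝ) ^ k := by
    rw [← pow_add, Nat.sub_add_cancel hk]
  push_cast
  rw [← hM k hk, weight_eq, e]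
  ring

/-! ### Comparison of the two estimates -/

/-- If the value `b * remainderSum 0` is an integer then the linear combination is trivial. -/
lemma coeff_eq_zero_of_int {p r : ℕ} (hr : 0 < r) {c : ℕ → ℤ} {a b : ℤ} (ha : a ≠ 0) (hb : b ≠ 0)
    (h0 : ∃ M : ℤ, (b : ℝ) * remainderSum (p + r) r (fun j => (c j : ℝ)) ((a : ℝ) / b) 0 = M) :
    ∀ j < p + r, c j = 0 := by
  have ha' : (a : ℝ) ≠ 0 := by exact_mod_cast ha
  have hb' : (b : ℝ) ≠ 0 := by exact_mod_cast hb
  set z : ℝ := (a : ℝ) / b with hz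
  set E := remainderSum (p + r) r (fun j => (c j : ℝ)) z with hEdef
  have hE : ∀ k, E (k + 1) = (b : ℝ) / a * E k - lam (p + r) r (fun j => (c j : ℝ)) k := by
    intro k
    rw [hEdef, rem_eq hr _ z k, hz]
    field_simp
    ring
  by_contra! hc
  obtain ⟨j, hj, hcj⟩ := hc
  set A := ∑ j ∈ Finset.range (p + r), |(c j : ℝ)|
  set T := ∑' m : ℕ, |z| ^ m / (m.factorial : ℝ)
  set D := Real.exp (Real.log 4 + 4)
  set q := p + r with hq
  set B := |(a : ℝ)| ^ q * |(b : ℝ)| * D ^ (q * q) * 2 ^ q * (2 ^ q) ^ p * (2 ^ q) ^ q * A * |z| * T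
  set K := |(a : ℝ)| ^ q * D ^ (q * q) * 2 ^ q * (2 ^ (q + 1)) ^ p * (2 ^ q) ^ q * |z|
  -- `B` collects the factors independent of `n` in the product of the two bounds, `K` the base of
  -- its exponential growth.
  have key : ∀ n : ℕ, (n.factorial : ℝ) ≤ B * K ^ n := by
    intro n
    obtain ⟨s, hs, hF⟩ : ∃ s ≤ p + r,
        altSum ((p + r) * (n + 1)) (fun k => weight p r n s k * E k) ≠ 0 := by
      by_contra! hall
      refine hcj ?_
      have := coeff_eq_zero_of_altSum_eq_zero (n := n) (by omega : 0 < p + r) hE (fun s hs => by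
        rw [← hall s hs]
        refine altSum_congr fun k _ => ?_
        rw [weight]
        ring) j hj
      exact_mod_cast this
    have hup := abs_altSum_weight_mul_rem_le (n := n) hr hs (fun j => (c j : ℝ)) z
    rw [← hEdef] at hup
    obtain ⟨M, hM⟩ := exists_int_altSum_weight (n := n) (s := s)
      (exists_int_recurrence (d := Nat.lcmUpto ((p + r) * (n + 1)))
        (fun k hk => Finset.dvd_lcm (f := id) (Finset.mem_Icc.mpr ⟨by omega, hk⟩)) ha hE h0)
    have hd := lcmUpto_le_exp_pow ((p + r) * (n + 1))
    have hd0 : (0 : ℝ) < Nat.lcmUpto ((p + r) * (n + 1)) := by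
      exact_mod_cast Nat.lcmUpto_pos _
    rw [← hq] at hd hd0 hM hF hup
    generalize (Nat.lcmUpto (q * (n + 1)) : ℝ) = d at *
    generalize altSum (q * (n + 1)) (fun k => weight p r n s k * E k) = F at *
    have hn : (0 : ℝ) < n.factorial := by positivity
    have hn1 : (1 : ℝ) ≤ n.factorial := by exact_mod_cast Nat.factorial_pos n
    have hM1 : (1 : ℝ) ≤ |(M : ℝ)| := by
      have : M ≠ 0 := by
        rintro rfl
        rw [Int.cast_zero, mul_zero] at hM
        have : (a : ℝ) ^ (q * (n + 1)) * b * d ^ q * F ≠ 0 := by positivity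
        exact this hM
      exact_mod_cast Int.one_le_abs this
    have h1 : (n.factorial : ℝ) ^ q ≤ |(a : ℝ)| ^ (q * (n + 1)) * |(b : ℝ)| * d ^ q * |F| := by
      have := congrArg abs hM
      rw [abs_mul, abs_mul, abs_mul, abs_mul, abs_pow, abs_pow, abs_pow, abs_of_pos hd0,
        Nat.abs_cast] at this
      rw [this]
      exact le_mul_of_one_le_right (by positivity) hM1
    have hD : 0 < D := Real.exp_pos _
    -- As `r ≥ 1`, one factor `n!` survives after cancelling `n! ^ p`.
    have h2 : (n.factorial : ℝ) ^ p * (n.factorial : ℝ) ≤ (n.factorial : ℝ) ^ p * (B * K ^ n) := by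
      calc (n.factorial : ℝ) ^ p * (n.factorial : ℝ) ≤ (n.factorial : ℝ) ^ p * (n.factorial : ℝ) ^ r := by
            gcongr
            exact le_self_pow₀ hn1 hr.ne'
        _ = (n.factorial : ℝ) ^ q := by rw [hq, pow_add]
        _ ≤ _ := h1
        _ ≤ |(a : ℝ)| ^ (q * (n + 1)) * |(b : ℝ)| * (D ^ (q * (n + 1))) ^ q *
            (2 ^ (q * (n + 1)) * ((n.factorial : ℝ) ^ p * (2 ^ (q * (n + 1) + n)) ^ p *
            (2 ^ (q * (n + 1))) ^ q * A) * |z| ^ (n + 1) * T) := by gcongr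
        _ = (n.factorial : ℝ) ^ p * (B * K ^ n) := by
            simp only [B, K]
            generalize (2 : ℝ) = t
            ring
    exact le_of_mul_le_mul_left h2 (by positivity)
  have hlim := (FloorSemiring.tendsto_pow_div_factorial_atTop K).const_mul B
  rw [mul_zero] at hlim
  obtain ⟨n, hn⟩ := (hlim.eventually (gt_mem_nhds one_pos)).exists
  rw [← mul_div_assoc, div_lt_one (by positivity)] at hn
  exact absurd (key n) (not_le.mpr hn)

/-! ### Linear independence and irrationality -/

lemma summable_confluentTerm {p q : ℕ} (hpq : p < q) {z : ℚ} (hz : z ≠ 0) (j : ℕ) :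
    Summable (confluentTerm p q z (j + 1)) := by
  have hz' : (z : ℝ) ≠ 0 := by exact_mod_cast hz
  -- The coefficients `Pi.single j 1` isolate one series, up to a factor `z`.
  have h := summable_lam (q := j + 1) (r := q - p) (by omega) (Pi.single j 1) (z : ℝ) 0
  refine (summable_mul_right_iff hz').mp (h.congr fun m => ?_)
  rw [lam, kap, Finset.sum_eq_single j]
  · simp only [confluentTerm, Pi.single_eq_same, add_zero]
    field_simp
    ring
  · intro i _ hij
    simp [hij]
  · simp

/-- A vanishing integral linear combination of `1` and the constants has trivial coefficients. -/
lemma coeff_eq_zero_of_relation {p q : ℕ} (hpq : p < q) {z : ℚ} (hz : z ≠ 0) {c₀ : ℤ} {c : ℕ → ℤ}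
    (h : (c₀ : ℝ) + ∑ j ∈ Finset.range q, (c j : ℝ) * confluentConst p q z (j + 1) = 0) :
    ∀ j < q, c j = 0 := by
  obtain ⟨r, rfl⟩ := Nat.exists_eq_add_of_le hpq.le
  have hr : 0 < r := by omega
  have hden : (z.den : ℤ) ≠ 0 := by exact_mod_cast z.den_nz
  have hzq : (z : ℝ) = (z.num : ℝ) / ((z.den : ℤ) : ℝ) := by
    rw [Int.cast_natCast]
    exact Rat.cast_def z
  -- The relation gives `E 0 = -c₀ * z`, so multiplying by the denominator of `z` leaves `-c₀ *
  -- z.num`.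
  refine coeff_eq_zero_of_int hr (Rat.num_ne_zero.mpr hz) hden ⟨-c₀ * z.num, ?_⟩
  have hrem : remainderSum (p + r) r (fun j => (c j : ℝ)) (z : ℝ) 0 = z * ∑ j ∈ Finset.range (p + r),
      (c j : ℝ) * confluentConst p (p + r) z (j + 1) := by
    simp only [confluentConst, ← tsum_mul_left]
    rw [← Summable.tsum_finsetSum fun j _ => (summable_confluentTerm hpq hz j).mul_left _,
      ← tsum_mul_left, remainderSum]
    refine tsum_congr fun m => ?_
    rw [lam, kap, Finset.sum_div, Finset.sum_mul, Finset.mul_sum]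
    refine Finset.sum_congr rfl fun j _ => ?_
    rw [confluentTerm, Nat.add_sub_cancel_left, add_zero]
    field_simp
    ring
  rw [← hzq, hrem, eq_neg_of_add_eq_zero_right h, hzq]
  have : ((z.den : ℤ) : ℝ) ≠ 0 := by exact_mod_cast hden
  push_cast at this ⊢
  field_simp

theorem mainTheorem12 (p q : ℕ) (hpq : p < q) (z : ℚ) (hz : z ≠ 0) :
    (∀ j : ℕ, 1 ≤ j → j ≤ q → Summable (confluentTerm p q z j)) ∧
    LinearIndependent ℚ
      (Fin.cons (1 : ℝ) (fun i : Fin q => confluentConst p q z ((i : ℕ) + 1)) :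
        Fin (q + 1) → ℝ) ∧
    (∀ j : ℕ, 1 ≤ j → j ≤ q → Irrational (confluentConst p q z j)) := by
  refine ⟨fun j hj _ => ?_, ?_, fun j hj hjq => ?_⟩
  · obtain ⟨i, rfl⟩ := Nat.exists_eq_add_of_le' hj
    exact summable_confluentTerm hpq hz i
  · rw [← LinearIndependent.iff_fractionRing ℤ ℚ, Fintype.linearIndependent_iff]
    intro g hg
    rw [Fin.sum_univ_succ] at hg
    simp only [Fin.cons_zero, Fin.cons_succ, zsmul_eq_mul, mul_one] at hg
    have hc := coeff_eq_zero_of_relation hpq hz (c₀ := g 0)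
      (c := fun j => if h : j < q then g (Fin.succ ⟨j, h⟩) else 0) (by
        rw [← hg, Finset.sum_range]
        simp)
    have hsucc : ∀ i : Fin q, g i.succ = 0 := fun i => by simpa using hc i i.2
    intro i
    refine Fin.cases ?_ hsucc i
    simpa [hsucc] using hg
  · obtain ⟨i, rfl⟩ := Nat.exists_eq_add_of_le' hj
    rintro ⟨ρ, hρ⟩
    -- A rational value `ρ` gives the relation `-ρ.num + ρ.den * ρ = 0`, forcing `ρ.den = 0`.
    have hc := coeff_eq_zero_of_relation hpq hz (c₀ := -ρ.num) (c := Pi.single i (ρ.den : ℤ)) (by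
      rw [Finset.sum_eq_single i]
      · rw [← hρ, Pi.single_eq_same, Rat.cast_def ρ]
        have : (ρ.den : ℝ) ≠ 0 := by exact_mod_cast ρ.den_nz
        push_cast
        field_simp
        ring
      · intro k _ hk
        simp [hk]
      · intro hi
        exact absurd (Finset.mem_range.mpr hjq) hi) i hjq
    rw [Pi.single_eq_same] at hc
    exact ρ.den_nz (by exact_mod_cast hc)
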